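/- Let $G$ be a (finite-dimensional) Lie group with identity $e$ and let $\pi:Q\to Q/G$ be a smooth left principal $G$-bundle with (free, proper) action $l^Q$; write $g\cdot q:=l^Q_g(q)$. Let $\gamma:Q\to G$ be a level function, i.e. a smooth map with $\gamma(g\cdot q)=g\,\gamma(q)\,g^{-1}$, put $\widetilde\gamma(q):=\gamma(q)\cdot q$ and $\Gamma:=\{(q,\widetilde\gamma(q)) : q\in Q\}\subseteq Q\times Q$. An affine discrete connection on $\pi$ with level $\gamma$ is an embedded submanifold $\mathrm{Hor}\subseteq Q\times Q$ that contains $\Gamma$, is invariant under the diagonal $G$-action, and is such that $(\mathrm{id}_Q\times\pi)|_{\mathrm{Hor}}:\mathrm{Hor}\to Q\times (Q/G)$ is an injective local diffeomorphism. Its domain is $\mathfrak U:=\{(q_0,g\cdot q_1) : (q_0,q_1)\in\mathrm{Hor},\ g\in G\}$. (1) Let $\mathrm{Hor}$ be an affine discrete connection on $\pi$ with level $\gamma$ and domain $\mathfrak U$. Then $\mathfrak U$ is open and $G\times G$-invariant, and for every $(q_0,q_1)\in\mathfrak U$ there is a unique $g\in G$ with $(q_0,g^{-1}\cdot q_1)\in\mathrm{Hor}$.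 The map $\mathcal A_d:\mathfrak U\to G$ defined by $\mathcal A_d(q_0,q_1):=g$ (the affine discrete connection form of $\mathrm{Hor}$) is smooth and satisfies, for all $(q_0,q_1)\in\mathfrak U$ and $g_0,g_1\in G$, $$\mathcal A_d(g_0\cdot q_0,\,g_1\cdot q_1)=g_1\,\mathcal A_d(q_0,q_1)\,g_0^{-1}.\qquad(*)$$ Moreover, $\mathrm{Hor}=\{(q_0,q_1)\in\mathfrak U : \mathcal A_d(q_0,q_1)=e\}$. (2) Conversely, let $\mathcal U\subseteq Q\times Q$ be an open, $G\times G$-invariant set containing $\Gamma$, and let $\mathcal A:\mathcal U\to G$ be a smooth map that satisfies $(*)$ on $\mathcal U$ (with $\mathcal A_d$ replaced by $\mathcal A$) and is equal to $e$ on $\Gamma$. Then $\mathrm{Hor}:=\{(q_0,q_1)\in\mathcal U : \mathcal A(q_0,q_1)=e\}$ is an affine discrete connection on $\pi$ with level $\gamma$, its domain is $\mathcal U$, and its affine discrete connection form is $\mathcal A$. -/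

import Mathlib

open scoped Manifold ContDiff

/-- A smooth (left) principal `G`-bundle `π : Q → B`, all manifolds being modelled on
the normed spaces `EG`, `EQ`, `EB`: the action of `G` on `Q` is smooth and free, `π` is a smooth
surjection whose fibres are exactly the `G`-orbits, and `π` is locally trivial by `G`-equivariant
diffeomorphisms `π⁻¹(U) → U × G` over `U`. -/
structure IsSmoothPrincipalBundle {EG EQ EB G Q B : Type*}
    [NormedAddCommGroup EG] [NormedSpace ℝ EG]
    [NormedAddCommGroup EQ] [NormedSpace ℝ EQ]
    [NormedAddCommGroup EB] [NormedSpace ℝ EB]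
    [TopologicalSpace G] [ChartedSpace EG G] [Group G]
    [TopologicalSpace Q] [ChartedSpace EQ Q]
    [TopologicalSpace B] [ChartedSpace EB B]
    [MulAction G Q] (π : Q → B) : Prop where
  contMDiff_smul : ContMDiff (𝓘(ℝ, EG).prod 𝓘(ℝ, EQ)) 𝓘(ℝ, EQ) ∞ (fun p : G × Q => p.1 • p.2)
  free : ∀ (g : G) (q : Q), g • q = q → g = 1
  contMDiff_proj : ContMDiff 𝓘(ℝ, EQ) 𝓘(ℝ, EB) ∞ π
  surjective_proj : Function.Surjective π
  proj_eq_iff : ∀ q q' : Q, π q = π q' ↔ ∃ g : G, g • q = q'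
  locally_trivial : ∀ b : B, ∃ (U : Set B) (Φ : OpenPartialHomeomorph Q (B × G)),
    IsOpen U ∧ b ∈ U ∧ Φ.source = π ⁻¹' U ∧ Φ.target = U ×ˢ Set.univ ∧
    ContMDiffOn 𝓘(ℝ, EQ) (𝓘(ℝ, EB).prod 𝓘(ℝ, EG)) ∞ Φ Φ.source ∧
    ContMDiffOn (𝓘(ℝ, EB).prod 𝓘(ℝ, EG)) 𝓘(ℝ, EQ) ∞ Φ.symm Φ.target ∧
    (∀ q ∈ Φ.source, (Φ q).1 = π q) ∧
    (∀ q ∈ Φ.source, ∀ g : G, (Φ (g • q)).2 = g * (Φ q).2)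

/-- A level function: a smooth map `γ : Q → G` that is equivariant for the action on `Q` and
conjugation on `G`. -/
structure IsLevelFunction {EG EQ G Q : Type*}
    [NormedAddCommGroup EG] [NormedSpace ℝ EG]
    [NormedAddCommGroup EQ] [NormedSpace ℝ EQ]
    [TopologicalSpace G] [ChartedSpace EG G] [Group G]
    [TopologicalSpace Q] [ChartedSpace EQ Q]
    [MulAction G Q] (γ : Q → G) : Prop where
  contMDiff : ContMDiff 𝓘(ℝ, EQ) 𝓘(ℝ, EG) ∞ γ
  equivariant : ∀ (g : G) (q : Q), γ (g • q) = g * γ q * g⁻¹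

/-- The graph `Γ` of `q ↦ γ(q) • q`. -/
def levelGraph {G Q : Type*} [Group G] [MulAction G Q] (γ : Q → G) : Set (Q × Q) :=
  {p | p.2 = γ p.1 • p.1}

/-- An affine discrete connection with level `γ` on `π : Q → B`: a subset `Hor` of `Q × Q` that
contains `Γ`, is invariant under the diagonal action, and is an embedded submanifold (it carries,
on the subspace topology, a smooth structure making the inclusion a smooth embedding) on which
`(q₀, q₁) ↦ (q₀, π q₁)` is an injective local diffeomorphism into `Q × B`. -/
structure IsAffineDiscreteConnection {EQ EB G Q B : Type*}
    [NormedAddCommGroup EQ] [NormedSpace ℝ EQ]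
    [NormedAddCommGroup EB] [NormedSpace ℝ EB]
    [Group G]
    [TopologicalSpace Q] [ChartedSpace EQ Q]
    [TopologicalSpace B] [ChartedSpace EB B]
    [MulAction G Q] (π : Q → B) (γ : Q → G) (Hor : Set (Q × Q)) : Prop where
  levelGraph_subset : levelGraph γ ⊆ Hor
  invariant : ∀ (g : G) (q₀ q₁ : Q), (q₀, q₁) ∈ Hor → (g • q₀, g • q₁) ∈ Hor
  submanifold : ∃ (k : ℕ) (_ : ChartedSpace (EuclideanSpace ℝ (Fin k)) Hor),
    IsManifold 𝓘(ℝ, EuclideanSpace ℝ (Fin k)) ∞ Hor ∧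
    Manifold.IsSmoothEmbedding 𝓘(ℝ, EuclideanSpace ℝ (Fin k)) (𝓘(ℝ, EQ).prod 𝓘(ℝ, EQ)) ∞
      (Subtype.val : Hor → Q × Q) ∧
    IsLocalDiffeomorph 𝓘(ℝ, EuclideanSpace ℝ (Fin k)) (𝓘(ℝ, EQ).prod 𝓘(ℝ, EB)) ∞
      (fun x : Hor => (x.1.1, π x.1.2))
  injOn : Set.InjOn (fun p : Q × Q => (p.1, π p.2)) Hor

/-- The domain `𝔘` of an affine discrete connection: the saturation of `Hor` under the action of
`G` on the second factor. -/
def connectionDomain (G : Type*) {Q : Type*} [Group G] [MulAction G Q] (Hor : Set (Q × Q)) :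
    Set (Q × Q) :=
  {p | ∃ g : G, ∃ q ∈ Hor, p = (q.1, g • q.2)}

open Classical in
/-- The affine discrete connection form: for `(q₀, q₁) ∈ 𝔘` it is the element `g` with
`(q₀, g⁻¹ • q₁) ∈ Hor` (outside `𝔘` there is none, and the value is irrelevant). -/
noncomputable def connectionForm (G : Type*) {Q : Type*} [Group G] [MulAction G Q]
    (Hor : Set (Q × Q)) (p : Q × Q) : G :=
  if h : ∃ g : G, (p.1, g⁻¹ • p.2) ∈ Hor then h.choose else 1

/-- Invariance of a subset of `Q × Q` under the action of `G × G`. -/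
def IsProdInvariant (G : Type*) {Q : Type*} [Group G] [MulAction G Q] (U : Set (Q × Q)) : Prop :=
  ∀ (g₀ g₁ : G) (q₀ q₁ : Q), (q₀, q₁) ∈ U → (g₀ • q₀, g₁ • q₁) ∈ U

/-- `A (g₀ • q₀, g₁ • q₁) = g₁ A(q₀, q₁) g₀⁻¹` for all `(q₀, q₁) ∈ U` and `g₀, g₁ ∈ G`. -/
def IsConnectionEquivariantOn {G Q : Type*} [Group G] [MulAction G Q]
    (A : Q × Q → G) (U : Set (Q × Q)) : Prop :=
  ∀ (g₀ g₁ : G) (q₀ q₁ : Q), (q₀, q₁) ∈ U →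
    A (g₀ • q₀, g₁ • q₁) = g₁ * A (q₀, q₁) * g₀⁻¹

/-!
An affine discrete connection `Hor` and its form `A` determine each other because `Hor` is a slice
for the action of `G` on the second factor: every pair in the domain is moved into `Hor` by exactly
one group element, by freeness of the action and injectivity of `(q₀, q₁) ↦ (q₀, π q₁)` on `Hor`.

From `Hor` to `A`: the domain is the preimage of the image of `Hor` in `Q × B`, which is open since
`Hor → Q × B` is a local diffeomorphism. A local inverse of that map gives a smooth `σ` with
`(q₀, σ) ∈ Hor` and `σ` in the fibre of `q₁`, and in an equivariant fibre coordinate `τ` the form is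
`τ(q₁) τ(σ)⁻¹`, hence smooth (`IsSmoothPrincipalBundle.contMDiffOn_connectionForm`).

From `A` to `Hor`: equivariance makes `(q₀, q₁) ↦ ((q₀, π q₁), A(q₀, q₁))` a diffeomorphism from
`U` onto `V × G` with `V` open in `Q × B`
(`IsSmoothPrincipalBundle.exists_partialDiffeomorph`). It carries `{A = 1}` to the slice `V × {1}`.
Hence `{A = 1} → Q × B` is an open embedding, along which the smooth structure of `Q × B` is pulled
back (`Topology.IsOpenEmbedding.exists_isLocalDiffeomorph`), and the same diffeomorphism is a slice
chart, so that the inclusion into `Q × Q` is an immersion with complement the model space of `G`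
(`isImmersionAtOfComplement_of_slice`). The definition of an immersion asks for a linear
isomorphism of model spaces; it exists for dimension reasons, as the differential of a local
trivialization gives `dim Q = dim B + dim G`.
-/

open Set Topology Manifold

/-! ### Partial diffeomorphisms, charts and immersions -/

section PartialDiffeomorph

variable {𝕜 : Type*} [NontriviallyNormedField 𝕜]
  {E : Type*} [NormedAddCommGroup E] [NormedSpace 𝕜 E]
  {E' : Type*} [NormedAddCommGroup E'] [NormedSpace 𝕜 E']
  {F : Type*} [NormedAddCommGroup F] [NormedSpace 𝕜 F]
  {E'' : Type*} [NormedAddCommGroup E''] [NormedSpace 𝕜 E'']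
  {H : Type*} [TopologicalSpace H] {H'' : Type*} [TopologicalSpace H'']
  {I : ModelWithCorners 𝕜 E H} {J : ModelWithCorners 𝕜 E'' H''}
  {M : Type*} [TopologicalSpace M] {N : Type*} [TopologicalSpace N]
  {n : ℕ∞ω}

variable (I n) in
/-- The preferred extended chart at a point of a boundaryless manifold, as a diffeomorphism between
open subsets of the manifold and of its model vector space. -/
noncomputable def extChartDiffeomorph [I.Boundaryless] [ChartedSpace H M] [IsManifold I n M]
    (x : M) : PartialDiffeomorph I 𝓘(𝕜, E) M E n where
  toPartialEquiv := extChartAt I x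
  open_source := isOpen_extChartAt_source x
  open_target := isOpen_extChartAt_target x
  contMDiffOn_toFun := by
    simpa [extChartAt_source] using contMDiffOn_extChartAt
  contMDiffOn_invFun := contMDiffOn_extChartAt_symm x

/-- A homeomorphism between open subsets of a manifold and of its model vector space which is
smooth in both directions becomes a chart of the maximal atlas once it is read in the model
space. -/
lemma PartialDiffeomorph.trans_symm_mem_maximalAtlas [I.Boundaryless] [ChartedSpace H M]
    [IsManifold I n M] (Φ : PartialDiffeomorph I 𝓘(𝕜, E) M E n) :
    Φ.toOpenPartialHomeomorph.trans I.toHomeomorph.symm.toOpenPartialHomeomorph ∈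
      IsManifold.maximalAtlas I n M := by
  apply OpenPartialHomeomorph.mem_maximalAtlas_of_contMDiffOn
  · have h : ContMDiffOn 𝓘(𝕜, E) I n I.symm univ := by
      simpa [I.range_eq_univ] using (I.contMDiffOn_symm (n := n))
    exact h.comp (Φ.contMDiffOn_toFun.mono (by intro x hx; simpa using hx)) (fun _ _ => mem_univ _)
  · refine Φ.contMDiffOn_invFun.comp I.contMDiff.contMDiffOn ?_
    intro x hx
    simpa using hx

/-- The diffeomorphism underlying a continuous linear equivalence. -/
noncomputable def ContinuousLinearEquiv.toPartialDiffeomorph (e : E ≃L[𝕜] E') :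
    PartialDiffeomorph 𝓘(𝕜, E) 𝓘(𝕜, E') E E' n where
  toPartialEquiv := e.toHomeomorph.toPartialEquiv
  open_source := isOpen_univ
  open_target := isOpen_univ
  contMDiffOn_toFun := e.contDiff.contMDiff.contMDiffOn
  contMDiffOn_invFun := e.symm.contDiff.contMDiff.contMDiffOn

/-- A space with an open embedding `f` into a boundaryless manifold carries a smooth structure that
makes `f` a local diffeomorphism; it may be modelled on any vector space that is linearly
homeomorphic to the model vector space of the target. -/
lemma Topology.IsOpenEmbedding.exists_isLocalDiffeomorph [I.Boundaryless] [ChartedSpace H N]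
    [IsManifold I n N] {f : M → N} (hf : IsOpenEmbedding f) (L : E ≃L[𝕜] E') :
    ∃ _ : ChartedSpace E' M, IsManifold 𝓘(𝕜, E') n M ∧ IsLocalDiffeomorph 𝓘(𝕜, E') I n f := by
  cases isEmpty_or_nonempty M with
  | inl h =>
    let cs := ChartedSpace.empty E' M
    exact ⟨cs, isManifold_of_contDiffOn _ _ _ fun _ _ he => absurd he (notMem_empty _),
      fun x => h.elim x⟩
  | inr h =>
    let F₀ : OpenPartialHomeomorph M N := hf.toOpenPartialHomeomorph f
    let D (x : M) : PartialDiffeomorph I 𝓘(𝕜, E') N E' n :=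
      (extChartDiffeomorph I n (f x)).trans L.toPartialDiffeomorph
    let c (x : M) : OpenPartialHomeomorph M E' := F₀.trans (D x).toOpenPartialHomeomorph
    have hD (x : M) : f x ∈ (D x).source := by
      simp [D, extChartDiffeomorph, ContinuousLinearEquiv.toPartialDiffeomorph]
    have hc (x : M) : x ∈ (c x).source := by
      refine ⟨?_, hD x⟩
      simp [F₀]
    let cs : ChartedSpace E' M :=
      { atlas := range c
        chartAt := c
        mem_chart_source := hc
        chart_mem_atlas := fun x => mem_range_self x }
    have hFinv {y : N} (hy : y ∈ range f) : f (F₀.symm y) = y :=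
      F₀.right_inv (x := y) (by simpa [F₀] using hy)
    have : IsManifold 𝓘(𝕜, E') n M := by
      apply isManifold_of_contDiffOn
      rintro _ _ ⟨x, rfl⟩ ⟨y, rfl⟩
      rw [← contMDiffOn_iff_contDiffOn]
      have key : ContMDiffOn 𝓘(𝕜, E') 𝓘(𝕜, E') n (D y ∘ (D x).toPartialEquiv.symm)
          ((D x).target ∩ (D x).toPartialEquiv.symm ⁻¹' (D y).source) :=
        (D y).contMDiffOn_toFun.comp ((D x).contMDiffOn_invFun.mono inter_subset_left)
          inter_subset_right
      have hset : ∀ u ∈ ((c x).symm.trans (c y)).source, u ∈ (D x).target ∧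
          (D x).toPartialEquiv.symm u ∈ range f ∧ f (F₀.symm ((D x).toPartialEquiv.symm u)) ∈
            (D y).source := by
        intro u hu
        have h1 : u ∈ (D x).target := hu.1.1
        have h2 : (D x).toPartialEquiv.symm u ∈ F₀.target := hu.1.2
        have h3 : f (F₀.symm ((D x).toPartialEquiv.symm u)) ∈ (D y).source := hu.2.2
        exact ⟨h1, by simpa [F₀] using h2, h3⟩
      have hsub : ContMDiffOn 𝓘(𝕜, E') 𝓘(𝕜, E') n ((c x).symm.trans (c y))
          ((c x).symm.trans (c y)).source := by
        refine key.congr_mono (fun u hu => ?_) fun u hu => ?_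
        · obtain ⟨h1, h2, h3⟩ := hset u hu
          show D y (f (F₀.symm ((D x).toPartialEquiv.symm u))) = _
          rw [hFinv h2]
          rfl
        · obtain ⟨h1, h2, h3⟩ := hset u hu
          rw [hFinv h2] at h3
          exact ⟨h1, h3⟩
      exact hsub.mono fun u hu => by simpa using hu
    refine ⟨cs, inferInstance, fun x => ?_⟩
    have hcx : c x ∈ IsManifold.maximalAtlas 𝓘(𝕜, E') n M :=
      IsManifold.chart_mem_maximalAtlas (I := 𝓘(𝕜, E')) (n := n) x
    refine ⟨(⟨(c x).toPartialEquiv, (c x).open_source, (c x).open_target,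
      contMDiffOn_of_mem_maximalAtlas hcx, contMDiffOn_symm_of_mem_maximalAtlas hcx⟩ :
      PartialDiffeomorph 𝓘(𝕜, E') 𝓘(𝕜, E') M E' n).trans (D x).symm, ?_, ?_⟩
    · exact ⟨hc x, (D x).map_source (hD x)⟩
    · intro y hy
      exact ((D x).left_inv (x := f y) hy.1.2).symm

/-- A map `f` that becomes `p ↦ (p, y₀)` after a diffeomorphism between open subsets of the target
and of a product `P × Y`, and a diffeomorphism between open subsets of the source and of `P`, is an
immersion whose complement is the model space of `Y`. -/
lemma isImmersionAtOfComplement_of_slice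
    {HP : Type*} [TopologicalSpace HP] {EP : Type*} [NormedAddCommGroup EP] [NormedSpace 𝕜 EP]
    {K : ModelWithCorners 𝕜 EP HP} [K.Boundaryless] [J.Boundaryless]
    [ChartedSpace E' M] [IsManifold 𝓘(𝕜, E') n M] [ChartedSpace H'' N] [IsManifold J n N]
    {P : Type*} [TopologicalSpace P] [ChartedSpace HP P] [IsManifold K n P]
    {Y : Type*} [TopologicalSpace Y] [ChartedSpace F Y] [IsManifold 𝓘(𝕜, F) n Y]
    {f : M → N} {x : M} {y₀ : Y}
    (Φ : PartialDiffeomorph 𝓘(𝕜, E') K M P n)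
    (Ψ : PartialDiffeomorph J (K.prod 𝓘(𝕜, F)) N (P × Y) n)
    (hx : x ∈ Φ.source) (hfx : f x ∈ Ψ.source) (hf : ContinuousAt f x)
    (hΨ : ∀ m ∈ Φ.source, Ψ (f m) = (Φ m, y₀))
    (L : EP ≃L[𝕜] E') (e : (E' × F) ≃L[𝕜] E'') :
    IsImmersionAtOfComplement F 𝓘(𝕜, E') J n f x := by
  let cP := extChartDiffeomorph K n (Φ x)
  let cPY := extChartDiffeomorph (K.prod 𝓘(𝕜, F)) n (Φ x, y₀)
  -- The chart of `Y` is translated so that the slice `Y = y₀` sits at the origin.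
  let T : PartialDiffeomorph 𝓘(𝕜, EP × F) 𝓘(𝕜, EP × F) (EP × F) (EP × F) n :=
    { toPartialEquiv := (Equiv.subRight ((0 : EP), extChartAt 𝓘(𝕜, F) y₀ y₀)).toPartialEquiv
      open_source := isOpen_univ
      open_target := isOpen_univ
      contMDiffOn_toFun := by
        rw [contMDiffOn_iff_contDiffOn]
        exact (contDiff_id.sub contDiff_const).contDiffOn
      contMDiffOn_invFun := by
        rw [contMDiffOn_iff_contDiffOn]
        exact (contDiff_id.add contDiff_const).contDiffOn }
  let dM := (Φ.trans cP).trans L.toPartialDiffeomorph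
  let dN := ((Ψ.trans cPY).trans T).trans
    ((L.prodCongr (ContinuousLinearEquiv.refl 𝕜 F)).trans e).toPartialDiffeomorph
  refine IsImmersionAtOfComplement.mk_of_continuousAt hf e _ _ ?_ ?_
    dM.trans_symm_mem_maximalAtlas dN.trans_symm_mem_maximalAtlas ?_
  · simp [dM, cP, extChartDiffeomorph, ContinuousLinearEquiv.toPartialDiffeomorph, hx]
  · have h : Ψ.toPartialEquiv (f x) = (Φ.toPartialEquiv x, y₀) := hΨ x hx
    simp [dN, cPY, T, extChartDiffeomorph, ContinuousLinearEquiv.toPartialDiffeomorph, hfx, h]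
  · intro u hu
    have hu' : u ∈ dM.target := by simpa using hu
    have hm : dM.toPartialEquiv.symm u ∈ Φ.source := (dM.map_target hu').1.1
    have hr : dM.toPartialEquiv (dM.toPartialEquiv.symm u) = u := dM.right_inv hu'
    set m := dM.toPartialEquiv.symm u
    have h : Ψ.toPartialEquiv (f m) = (Φ.toPartialEquiv m, y₀) := hΨ m hm
    have hN : dN.toPartialEquiv (f m) = e (u, 0) := by
      rw [← hr]
      simp [dN, dM, cP, cPY, T, extChartDiffeomorph, ContinuousLinearEquiv.toPartialDiffeomorph, h]
    show J (J.symm (dN.toPartialEquiv (f m))) = e (u, 0)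
    rw [hN]
    exact J.right_inv (by simp [J.range_eq_univ])

/-- A level set of the last coordinate of a straightening maps by an open embedding to the other
coordinates. -/
lemma PartialDiffeomorph.isOpenEmbedding_slice {𝕜 EN HN EP HP N P Y EY HY : Type*}
    [NontriviallyNormedField 𝕜]
    [NormedAddCommGroup EN] [NormedSpace 𝕜 EN] [TopologicalSpace HN] {J : ModelWithCorners 𝕜 EN HN}
    [NormedAddCommGroup EP] [NormedSpace 𝕜 EP] [TopologicalSpace HP] {K : ModelWithCorners 𝕜 EP HP}
    [NormedAddCommGroup EY] [NormedSpace 𝕜 EY] [TopologicalSpace HY] {I : ModelWithCorners 𝕜 EY HY}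
    [TopologicalSpace N] [ChartedSpace HN N] [TopologicalSpace P] [ChartedSpace HP P]
    [TopologicalSpace Y] [ChartedSpace HY Y] {n : ℕ∞ω}
    (Ψ : PartialDiffeomorph J (K.prod I) N (P × Y) n) {V : Set P} (hV : IsOpen V)
    (ht : Ψ.target = V ×ˢ univ) {f : N → P} {a : N → Y}
    (hΨ : ∀ p, Ψ.toPartialEquiv p = (f p, a p)) (y₀ : Y) :
    IsOpenEmbedding (fun x : {p | p ∈ Ψ.source ∧ a p = y₀} => f x.1) := by
  have hmem (v : P) (hv : v ∈ V) : (v, y₀) ∈ Ψ.target := by rw [ht]; exact ⟨hv, mem_univ _⟩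
  have hpair (x : {p | p ∈ Ψ.source ∧ a p = y₀}) : Ψ.toPartialEquiv x.1 = (f x.1, y₀) := by
    rw [hΨ, x.2.2]
  refine IsOpenEmbedding.of_continuous_injective_isOpenMap ?_ ?_ ?_
  · have hf : ContinuousOn f Ψ.source := by
      simpa [Function.comp_def, hΨ] using
        continuous_fst.comp_continuousOn Ψ.contMDiffOn_toFun.continuousOn
    exact hf.comp_continuous continuous_subtype_val fun x => x.2.1
  · intro x y hxy
    refine Subtype.ext (Ψ.injOn x.2.1 y.2.1 ?_)
    rw [hpair x, hpair y]
    exact congrArg (·, y₀) hxy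
  · rintro _ ⟨O, hO, rfl⟩
    have hc : ContinuousOn (fun v => Ψ.toPartialEquiv.symm (v, y₀)) V :=
      Ψ.contMDiffOn_invFun.continuousOn.comp (by fun_prop) hmem
    convert hc.isOpen_inter_preimage hV hO using 1
    ext v
    constructor
    · rintro ⟨x, hx, rfl⟩
      have h1 := Ψ.map_source x.2.1
      rw [hpair x, ht] at h1
      refine ⟨h1.1, ?_⟩
      rw [mem_preimage, ← hpair x, Ψ.left_inv x.2.1]
      exact hx
    · rintro ⟨hv, hvO⟩
      have hr := Ψ.right_inv (hmem v hv)
      rw [hΨ] at hr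
      exact ⟨⟨Ψ.toPartialEquiv.symm (v, y₀), Ψ.map_target (hmem v hv), (Prod.ext_iff.1 hr).2⟩, hvO,
        (Prod.ext_iff.1 hr).1⟩

end PartialDiffeomorph

/-! ### Local structure of a principal bundle -/

section Bundle

variable {EG EQ EB G Q B : Type*}
  [NormedAddCommGroup EG] [NormedSpace ℝ EG]
  [NormedAddCommGroup EQ] [NormedSpace ℝ EQ]
  [NormedAddCommGroup EB] [NormedSpace ℝ EB]
  [TopologicalSpace G] [ChartedSpace EG G] [Group G]
  [TopologicalSpace Q] [ChartedSpace EQ Q]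
  [TopologicalSpace B] [ChartedSpace EB B]
  [MulAction G Q] {π : Q → B}

namespace IsSmoothPrincipalBundle

lemma proj_smul (hπ : IsSmoothPrincipalBundle (EG := EG) (EQ := EQ) (EB := EB) (G := G) π)
    (g : G) (q : Q) : π (g • q) = π q :=
  ((hπ.proj_eq_iff q (g • q)).2 ⟨g, rfl⟩).symm

lemma smul_left_injective
    (hπ : IsSmoothPrincipalBundle (EG := EG) (EQ := EQ) (EB := EB) (G := G) π)
    {g h : G} {q : Q} (hgh : g • q = h • q) : g = h := by
  have := hπ.free (h⁻¹ * g) q (by rw [mul_smul, hgh, inv_smul_smul])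
  exact (inv_mul_eq_one.1 this).symm

lemma exists_local_section
    (hπ : IsSmoothPrincipalBundle (EG := EG) (EQ := EQ) (EB := EB) (G := G) π) (b : B) :
    ∃ (W : Set B) (σ : B → Q), IsOpen W ∧ b ∈ W ∧ ContMDiffOn 𝓘(ℝ, EB) 𝓘(ℝ, EQ) ∞ σ W ∧
      ∀ b' ∈ W, π (σ b') = b' := by
  obtain ⟨W, Φ, hW, hb, hs, ht, -, hΦ', hπΦ, -⟩ := hπ.locally_trivial b
  have hmem : ∀ b' ∈ W, ((b', 1) : B × G) ∈ Φ.target := fun b' hb' => by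
    rw [ht]; exact ⟨hb', mem_univ _⟩
  refine ⟨W, fun b' => Φ.symm (b', 1), hW, hb, ?_, ?_⟩
  · exact hΦ'.comp (contMDiff_id.prodMk contMDiff_const).contMDiffOn hmem
  · intro b' hb'
    rw [← hπΦ _ (Φ.map_target (hmem b' hb')), Φ.right_inv (hmem b' hb')]

lemma exists_fibre_coordinate
    (hπ : IsSmoothPrincipalBundle (EG := EG) (EQ := EQ) (EB := EB) (G := G) π) (b : B) :
    ∃ (W : Set B) (τ : Q → G), IsOpen W ∧ b ∈ W ∧
      ContMDiffOn 𝓘(ℝ, EQ) 𝓘(ℝ, EG) ∞ τ (π ⁻¹' W) ∧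
      ∀ (g : G) (q : Q), π q ∈ W → τ (g • q) = g * τ q := by
  obtain ⟨W, Φ, hW, hb, hs, -, hΦ, -, -, hτ⟩ := hπ.locally_trivial b
  refine ⟨W, fun q => (Φ q).2, hW, hb, ?_, fun g q hq => hτ q (hs ▸ hq) g⟩
  rw [← hs]
  exact contMDiff_snd.comp_contMDiffOn hΦ

/-- The differential of a local trivialization identifies the model space of the total space with
the product of those of the base and of the group. -/
lemma finrank_eq
    (hπ : IsSmoothPrincipalBundle (EG := EG) (EQ := EQ) (EB := EB) (G := G) π) (q : Q) :
    Module.finrank ℝ EQ = Module.finrank ℝ (EB × EG) := by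
  obtain ⟨W, Φ, hW, hb, hs, ht, hΦ, hΦ', -, -⟩ := hπ.locally_trivial (π q)
  let Ψ : PartialDiffeomorph 𝓘(ℝ, EQ) (𝓘(ℝ, EB).prod 𝓘(ℝ, EG)) Q (B × G) ∞ :=
    ⟨Φ.toPartialEquiv, Φ.open_source, Φ.open_target, hΦ, hΦ'⟩
  have hq : q ∈ Ψ.source := by
    change q ∈ Φ.source
    rw [hs]; exact hb
  exact ((Ψ.isLocalDiffeomorphAt _ _ _ hq).mfderivToContinuousLinearEquiv
    (by simp)).toLinearEquiv.finrank_eq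

/-- Two points of `Hor` over the same point of `Q × B` coincide, so by freeness at most one group
element brings a given pair into `Hor`. -/
lemma inv_smul_mem_iff
    (hπ : IsSmoothPrincipalBundle (EG := EG) (EQ := EQ) (EB := EB) (G := G) π)
    {Hor : Set (Q × Q)} (hinj : InjOn (fun p : Q × Q => (p.1, π p.2)) Hor)
    {p : Q × Q} {g : G} (hg : (p.1, g⁻¹ • p.2) ∈ Hor) (h : G) :
    (p.1, h⁻¹ • p.2) ∈ Hor ↔ h = g := by
  refine ⟨fun hh => ?_, fun hh => hh ▸ hg⟩
  have := hinj hh hg (by simp [hπ.proj_smul])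
  exact inv_injective (hπ.smul_left_injective (congrArg Prod.snd this))

end IsSmoothPrincipalBundle
end Bundle

/-! ### Pairs of points under the action on the second factor -/

section Action

variable {G Q : Type*} [Group G] [MulAction G Q] {U Hor : Set (Q × Q)} {A : Q × Q → G}

lemma mem_connectionDomain_iff {p : Q × Q} :
    p ∈ connectionDomain G Hor ↔ ∃ g : G, (p.1, g⁻¹ • p.2) ∈ Hor := by
  constructor
  · rintro ⟨g, q, hq, rfl⟩
    exact ⟨g, by simpa using hq⟩
  · rintro ⟨g, hg⟩
    exact ⟨g, _, hg, by simp⟩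

lemma IsConnectionEquivariantOn.smul_right (hA : IsConnectionEquivariantOn A U) (g : G)
    {q₀ q₁ : Q} (h : (q₀, q₁) ∈ U) : A (q₀, g • q₁) = g * A (q₀, q₁) := by
  simpa using hA 1 g q₀ q₁ h

lemma IsProdInvariant.smul_right (hU : IsProdInvariant G U) (g : G)
    {q₀ q₁ : Q} (h : (q₀, q₁) ∈ U) : (q₀, g • q₁) ∈ U := by
  simpa using hU 1 g q₀ q₁ h

end Action

/-! ### The form of an affine discrete connection -/

section Bundle

variable {EG EQ EB G Q B : Type*}
  [NormedAddCommGroup EG] [NormedSpace ℝ EG]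
  [NormedAddCommGroup EQ] [NormedSpace ℝ EQ]
  [NormedAddCommGroup EB] [NormedSpace ℝ EB]
  [TopologicalSpace G] [ChartedSpace EG G] [Group G]
  [TopologicalSpace Q] [ChartedSpace EQ Q]
  [TopologicalSpace B] [ChartedSpace EB B]
  [MulAction G Q] {π : Q → B}

namespace IsSmoothPrincipalBundle

variable (hπ : IsSmoothPrincipalBundle (EG := EG) (EQ := EQ) (EB := EB) (G := G) π)
  {Hor : Set (Q × Q)} (hinj : InjOn (fun p : Q × Q => (p.1, π p.2)) Hor)

include hπ hinj

lemma connectionForm_eq {p : Q × Q} {g : G} (hg : (p.1, g⁻¹ • p.2) ∈ Hor) :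
    connectionForm G Hor p = g := by
  have h : ∃ g : G, (p.1, g⁻¹ • p.2) ∈ Hor := ⟨g, hg⟩
  rw [connectionForm, dif_pos h]
  exact (hπ.inv_smul_mem_iff hinj hg _).1 h.choose_spec

lemma inv_connectionForm_smul_mem {p : Q × Q} (hp : p ∈ connectionDomain G Hor) :
    (p.1, (connectionForm G Hor p)⁻¹ • p.2) ∈ Hor := by
  obtain ⟨g, hg⟩ := mem_connectionDomain_iff.1 hp
  rwa [hπ.connectionForm_eq hinj hg]

omit hinj in
lemma connectionDomain_eq_preimage_range :
    connectionDomain G Hor =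
      (fun p : Q × Q => (p.1, π p.2)) ⁻¹' range (fun x : Hor => (x.1.1, π x.1.2)) := by
  ext p
  rw [mem_connectionDomain_iff]
  constructor
  · rintro ⟨g, hg⟩
    exact ⟨⟨_, hg⟩, by simp [hπ.proj_smul]⟩
  · rintro ⟨⟨q, hq⟩, h⟩
    obtain ⟨g, hg⟩ := (hπ.proj_eq_iff _ _).1 (congrArg Prod.snd h)
    refine ⟨g, ?_⟩
    rw [← hg, inv_smul_smul, ← show q.1 = p.1 from (Prod.ext_iff.1 h).1]
    exact hq

/-- The second component of a local inverse of `Hor → Q × B` lies in the fibre of the second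
argument, and the connection form is the quotient of the two fibre coordinates. -/
lemma contMDiffOn_connectionForm [LieGroup 𝓘(ℝ, EG) ∞ G] {E : Type*} [NormedAddCommGroup E]
    [NormedSpace ℝ E] [ChartedSpace E Hor]
    (hval : ContMDiff 𝓘(ℝ, E) (𝓘(ℝ, EQ).prod 𝓘(ℝ, EQ)) ∞ (Subtype.val : Hor → Q × Q))
    (hloc : IsLocalDiffeomorph 𝓘(ℝ, E) (𝓘(ℝ, EQ).prod 𝓘(ℝ, EB)) ∞
      (fun x : Hor => (x.1.1, π x.1.2))) :
    ContMDiffOn (𝓘(ℝ, EQ).prod 𝓘(ℝ, EQ)) 𝓘(ℝ, EG) ∞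
      (connectionForm G Hor) (connectionDomain G Hor) := by
  intro p hp
  apply ContMDiffAt.contMDiffWithinAt
  have hx := hπ.inv_connectionForm_smul_mem hinj hp
  have hd := hloc ⟨_, hx⟩
  let s := hd.localInverse
  have hs₀ : (p.1, π p.2) ∈ s.source := by
    simpa [hπ.proj_smul] using hd.localInverse_mem_source
  have hs (y) (hy : y ∈ s.source) : ((s y).1.1, π (s y).1.2) = y := hd.localInverse_right_inv hy
  have hpr : ContMDiff (𝓘(ℝ, EQ).prod 𝓘(ℝ, EQ)) (𝓘(ℝ, EQ).prod 𝓘(ℝ, EB)) ∞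
      (fun p : Q × Q => (p.1, π p.2)) :=
    contMDiff_fst.prodMk (hπ.contMDiff_proj.comp contMDiff_snd)
  obtain ⟨W, τ, hW, hpW, hτ, hτmul⟩ := hπ.exists_fibre_coordinate (π p.2)
  have hτat (q : Q) (hq : π q ∈ W) : ContMDiffAt 𝓘(ℝ, EQ) 𝓘(ℝ, EG) ∞ τ q :=
    hτ.contMDiffAt ((hW.preimage hπ.contMDiff_proj.continuous).mem_nhds hq)
  let σ : Q × Q → Q := fun p => (s (p.1, π p.2)).1.2
  have hσ : ContMDiffAt (𝓘(ℝ, EQ).prod 𝓘(ℝ, EQ)) 𝓘(ℝ, EQ) ∞ σ p := by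
    have h1 : ContMDiffAt (𝓘(ℝ, EQ).prod 𝓘(ℝ, EB)) 𝓘(ℝ, E) ∞ s (p.1, π p.2) :=
      s.contMDiffOn_toFun.contMDiffAt (s.open_source.mem_nhds hs₀)
    exact contMDiff_snd.contMDiffAt.comp p
      (hval.contMDiffAt.comp p (ContMDiffAt.comp p h1 hpr.contMDiffAt))
  have hσp : π (σ p) = π p.2 := congrArg Prod.snd (hs _ hs₀)
  have hquot : ContMDiffAt (𝓘(ℝ, EQ).prod 𝓘(ℝ, EQ)) 𝓘(ℝ, EG) ∞
      (fun p => τ p.2 * (τ (σ p))⁻¹) p :=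
    ((hτat _ hpW).comp p contMDiff_snd.contMDiffAt).mul
      (((hτat _ (hσp ▸ hpW)).comp p hσ).inv)
  refine hquot.congr_of_eventuallyEq ?_
  have hnhds : (fun p : Q × Q => (p.1, π p.2)) ⁻¹' (s.source ∩ Prod.snd ⁻¹' W) ∈ 𝓝 p :=
    ((s.open_source.inter (hW.preimage continuous_snd)).preimage hpr.continuous).mem_nhds
      ⟨hs₀, hpW⟩
  filter_upwards [hnhds] with y hy
  have hy' := hs _ hy.1
  have hfib : π (σ y) = π y.2 := congrArg Prod.snd hy'
  obtain ⟨g, hg⟩ := (hπ.proj_eq_iff _ _).1 hfib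
  have hmem : (y.1, g⁻¹ • y.2) ∈ Hor := by
    rw [← hg, inv_smul_smul, ← show (s (y.1, π y.2)).1.1 = y.1 from (Prod.ext_iff.1 hy').1]
    exact (s (y.1, π y.2)).2
  rw [hπ.connectionForm_eq hinj hmem, ← hg, hτmul g _ (hfib ▸ hy.2), mul_inv_cancel_right]

lemma smul_inv_smul_mem (hinv : ∀ (g : G) (q₀ q₁ : Q), (q₀, q₁) ∈ Hor → (g • q₀, g • q₁) ∈ Hor)
    (g₀ g₁ : G) {q₀ q₁ : Q} (h : (q₀, q₁) ∈ connectionDomain G Hor) :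
    (g₀ • q₀, (g₁ * connectionForm G Hor (q₀, q₁) * g₀⁻¹)⁻¹ • g₁ • q₁) ∈ Hor := by
  simpa [mul_smul] using hinv g₀ _ _ (hπ.inv_connectionForm_smul_mem hinj h)

lemma isProdInvariant_connectionDomain
    (hinv : ∀ (g : G) (q₀ q₁ : Q), (q₀, q₁) ∈ Hor → (g • q₀, g • q₁) ∈ Hor) :
    IsProdInvariant G (connectionDomain G Hor) :=
  fun g₀ g₁ _ _ h => mem_connectionDomain_iff.2 ⟨_, hπ.smul_inv_smul_mem hinj hinv g₀ g₁ h⟩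

lemma isConnectionEquivariantOn_connectionForm
    (hinv : ∀ (g : G) (q₀ q₁ : Q), (q₀, q₁) ∈ Hor → (g • q₀, g • q₁) ∈ Hor) :
    IsConnectionEquivariantOn (connectionForm G Hor) (connectionDomain G Hor) :=
  fun g₀ g₁ _ _ h => hπ.connectionForm_eq hinj (hπ.smul_inv_smul_mem hinj hinv g₀ g₁ h)

lemma eq_setOf_connectionForm_eq_one :
    Hor = {p | p ∈ connectionDomain G Hor ∧ connectionForm G Hor p = 1} := by
  ext p
  constructor
  · intro hp
    have hp' : (p.1, (1 : G)⁻¹ • p.2) ∈ Hor := by simpa using hp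
    exact ⟨mem_connectionDomain_iff.2 ⟨1, hp'⟩, hπ.connectionForm_eq hinj hp'⟩
  · rintro ⟨hp, h1⟩
    simpa [h1] using hπ.inv_connectionForm_smul_mem hinj hp

end IsSmoothPrincipalBundle
end Bundle

/-! ### The unit level set of an equivariant map -/

section Slice

variable {EG EQ EB G Q B : Type*}
  [NormedAddCommGroup EG] [NormedSpace ℝ EG]
  [NormedAddCommGroup EQ] [NormedSpace ℝ EQ]
  [NormedAddCommGroup EB] [NormedSpace ℝ EB]
  [TopologicalSpace G] [ChartedSpace EG G] [Group G] [LieGroup 𝓘(ℝ, EG) ∞ G]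
  [TopologicalSpace Q] [ChartedSpace EQ Q]
  [TopologicalSpace B] [ChartedSpace EB B]
  [MulAction G Q] {π : Q → B}
  {U : Set (Q × Q)} {A : Q × Q → G}

/-- An equivariant map `A` straightens its domain: `(q₀, q₁) ↦ ((q₀, π q₁), A (q₀, q₁))` is a
diffeomorphism onto `V × G` for an open set `V`, namely the projection of `U` to `Q × B`. The
inverse sends `((q₀, b), g)` to `(q₀, g • A (q₀, q)⁻¹ • q)`, where `q` is any point over `b`. -/
lemma IsSmoothPrincipalBundle.exists_partialDiffeomorph
    (hπ : IsSmoothPrincipalBundle (EG := EG) (EQ := EQ) (EB := EB) (G := G) π)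
    (hUo : IsOpen U) (hU : IsProdInvariant G U)
    (hAs : ContMDiffOn (𝓘(ℝ, EQ).prod 𝓘(ℝ, EQ)) 𝓘(ℝ, EG) ∞ A U)
    (hA : IsConnectionEquivariantOn A U) :
    ∃ (Ψ : PartialDiffeomorph (𝓘(ℝ, EQ).prod 𝓘(ℝ, EQ))
        ((𝓘(ℝ, EQ).prod 𝓘(ℝ, EB)).prod 𝓘(ℝ, EG)) (Q × Q) ((Q × B) × G) ∞) (V : Set (Q × B)),
      Ψ.source = U ∧ IsOpen V ∧ Ψ.target = V ×ˢ univ ∧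
      ∀ p, Ψ.toPartialEquiv p = ((p.1, π p.2), A p) := by
  let ρ : B → Q := Function.surjInv hπ.surjective_proj
  have hρ (b) : π (ρ b) = b := Function.surjInv_eq hπ.surjective_proj b
  let V : Set (Q × B) := {x | (x.1, ρ x.2) ∈ U}
  -- The point `A (q₀, q)⁻¹ • q` depends only on `q₀` and on the fibre of `q`.
  have hfib {q q' : Q} (h : π q = π q') {q₀ : Q} (hq : (q₀, q) ∈ U) : (q₀, q') ∈ U ∧
      (A (q₀, q'))⁻¹ • q' = (A (q₀, q))⁻¹ • q := by
    obtain ⟨g, rfl⟩ := (hπ.proj_eq_iff _ _).1 h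
    refine ⟨hU.smul_right g hq, ?_⟩
    rw [hA.smul_right g hq, mul_inv_rev, mul_smul, inv_smul_smul]
  have hVo : IsOpen V := by
    rw [isOpen_iff_mem_nhds]
    intro x hx
    obtain ⟨W, s, hW, hxW, hs, hπs⟩ := hπ.exists_local_section x.2
    have hc : ContinuousAt (fun y : Q × B => (y.1, s y.2)) x :=
      continuousAt_fst.prodMk
        ((hs.continuousOn.continuousAt (hW.mem_nhds hxW)).comp continuousAt_snd)
    have hxs : (x.1, s x.2) ∈ U := (hfib ((hρ _).trans (hπs _ hxW).symm) hx).1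
    -- Membership in `U` depends only on the fibre of the second point, so the smooth section `s`
    -- may replace `ρ`, which need not be continuous.
    filter_upwards [hc (hUo.mem_nhds hxs), (hW.preimage continuous_snd).mem_nhds hxW] with y hy hyW
    exact (hfib ((hπs _ hyW).trans (hρ _).symm) hy).1
  refine ⟨
    { toFun := fun p => ((p.1, π p.2), A p)
      invFun := fun x => (x.1.1, x.2 • (A (x.1.1, ρ x.1.2))⁻¹ • ρ x.1.2)
      source := U
      target := V ×ˢ univ
      map_source' := fun p hp => ⟨(hfib (hρ _).symm hp).1, mem_univ _⟩
      map_target' := fun x hx => hU.smul_right _ (hU.smul_right _ hx.1)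
      left_inv' := ?_
      right_inv' := ?_
      open_source := hUo
      open_target := hVo.prod isOpen_univ
      contMDiffOn_toFun :=
        (contMDiff_fst.prodMk (hπ.contMDiff_proj.comp contMDiff_snd)).contMDiffOn.prodMk hAs
      contMDiffOn_invFun := ?_ }, V, rfl, hVo, rfl, fun _ => rfl⟩
  · rintro ⟨q₀, q₁⟩ hp
    simp only [(hfib (hρ (π q₁)).symm hp).2, smul_inv_smul]
  · rintro ⟨⟨q₀, b⟩, g⟩ ⟨hx, -⟩
    have hx' : (q₀, ρ b) ∈ U := hx
    simp [hπ.proj_smul, hρ, hA.smul_right _ (hU.smul_right _ hx'), hA.smul_right _ hx']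
  · intro x hx
    apply ContMDiffAt.contMDiffWithinAt
    obtain ⟨W, s, hW, hxW, hs, hπs⟩ := hπ.exists_local_section x.1.2
    have hxs : (x.1.1, s x.1.2) ∈ U := (hfib ((hρ _).trans (hπs _ hxW).symm) hx.1).1
    have h0 : ContMDiffAt ((𝓘(ℝ, EQ).prod 𝓘(ℝ, EB)).prod 𝓘(ℝ, EG)) 𝓘(ℝ, EQ) ∞
        (fun y : (Q × B) × G => y.1.1) x := (contMDiff_fst.comp contMDiff_fst).contMDiffAt
    have h1 : ContMDiffAt ((𝓘(ℝ, EQ).prod 𝓘(ℝ, EB)).prod 𝓘(ℝ, EG)) 𝓘(ℝ, EQ) ∞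
        (fun y : (Q × B) × G => s y.1.2) x :=
      ContMDiffAt.comp x (hs.contMDiffAt (hW.mem_nhds hxW))
        (contMDiff_snd.comp contMDiff_fst).contMDiffAt
    have h2 : ContMDiffAt ((𝓘(ℝ, EQ).prod 𝓘(ℝ, EB)).prod 𝓘(ℝ, EG)) 𝓘(ℝ, EG) ∞
        (fun y : (Q × B) × G => A (y.1.1, s y.1.2)) x :=
      ContMDiffAt.comp x (hAs.contMDiffAt (hUo.mem_nhds hxs)) (h0.prodMk h1)
    have h3 : ContMDiffAt ((𝓘(ℝ, EQ).prod 𝓘(ℝ, EB)).prod 𝓘(ℝ, EG)) 𝓘(ℝ, EQ) ∞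
        (fun y : (Q × B) × G => (A (y.1.1, s y.1.2))⁻¹ • s y.1.2) x :=
      hπ.contMDiff_smul.contMDiffAt.comp x (h2.inv.prodMk h1)
    have h4 : ContMDiffAt ((𝓘(ℝ, EQ).prod 𝓘(ℝ, EB)).prod 𝓘(ℝ, EG)) 𝓘(ℝ, EQ) ∞
        (fun y : (Q × B) × G => y.2 • (A (y.1.1, s y.1.2))⁻¹ • s y.1.2) x :=
      hπ.contMDiff_smul.contMDiffAt.comp x (contMDiff_snd.contMDiffAt.prodMk h3)
    refine (h0.prodMk h4).congr_of_eventuallyEq ?_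
    filter_upwards [(hVo.prod isOpen_univ).mem_nhds hx,
      (hW.preimage (continuous_snd.comp continuous_fst)).mem_nhds hxW] with y hy hyW
    have hyW' : y.1.2 ∈ W := hyW
    rw [(hfib ((hρ _).trans (hπs _ hyW').symm) hy.1).2]

/-- The straightening of `U` by `A` provides both the smooth structure on the unit level set, pulled
back from `Q × B`, and the slice charts that make its inclusion an immersion. -/
lemma IsSmoothPrincipalBundle.exists_submanifold_levelSet
    [FiniteDimensional ℝ EG] [FiniteDimensional ℝ EQ] [FiniteDimensional ℝ EB]
    [IsManifold 𝓘(ℝ, EQ) ∞ Q] [IsManifold 𝓘(ℝ, EB) ∞ B]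
    (hπ : IsSmoothPrincipalBundle (EG := EG) (EQ := EQ) (EB := EB) (G := G) π)
    (hUo : IsOpen U) (hU : IsProdInvariant G U)
    (hAs : ContMDiffOn (𝓘(ℝ, EQ).prod 𝓘(ℝ, EQ)) 𝓘(ℝ, EG) ∞ A U)
    (hA : IsConnectionEquivariantOn A U) :
    ∃ (k : ℕ) (_ : ChartedSpace (EuclideanSpace ℝ (Fin k)) {p | p ∈ U ∧ A p = 1}),
      IsManifold 𝓘(ℝ, EuclideanSpace ℝ (Fin k)) ∞ {p | p ∈ U ∧ A p = 1} ∧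
      IsSmoothEmbedding 𝓘(ℝ, EuclideanSpace ℝ (Fin k)) (𝓘(ℝ, EQ).prod 𝓘(ℝ, EQ)) ∞
        (Subtype.val : {p | p ∈ U ∧ A p = 1} → Q × Q) ∧
      IsLocalDiffeomorph 𝓘(ℝ, EuclideanSpace ℝ (Fin k)) (𝓘(ℝ, EQ).prod 𝓘(ℝ, EB)) ∞
        (fun x : {p | p ∈ U ∧ A p = 1} => (x.1.1, π x.1.2)) := by
  obtain ⟨Ψ, V, rfl, hV, ht, hΨ⟩ := hπ.exists_partialDiffeomorph hUo hU hAs hA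
  have hemb : IsOpenEmbedding (fun x : {p | p ∈ Ψ.source ∧ A p = 1} => (x.1.1, π x.1.2)) :=
    Ψ.isOpenEmbedding_slice hV ht (f := fun p => (p.1, π p.2)) hΨ (1 : G)
  let L : (EQ × EB) ≃L[ℝ] EuclideanSpace ℝ (Fin (Module.finrank ℝ (EQ × EB))) := toEuclidean
  obtain ⟨cs, hman, hloc⟩ := hemb.exists_isLocalDiffeomorph
    (I := 𝓘(ℝ, EQ).prod 𝓘(ℝ, EB)) (n := ∞) L
  refine ⟨_, cs, hman, ⟨IsImmersionOfComplement.isImmersion (F := EG) fun x => ?_,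
    IsEmbedding.subtypeVal⟩, hloc⟩
  obtain ⟨Φ, hx, hΦ⟩ := hloc x
  have hdim : Module.finrank ℝ (EuclideanSpace ℝ (Fin (Module.finrank ℝ (EQ × EB))) × EG) =
      Module.finrank ℝ (EQ × EQ) := by
    have := hπ.finrank_eq x.1.1
    simp only [Module.finrank_prod, finrank_euclideanSpace, Fintype.card_fin] at this ⊢
    lia
  refine isImmersionAtOfComplement_of_slice (y₀ := (1 : G)) Φ Ψ hx x.2.1
    continuous_subtype_val.continuousAt (fun m hm => ?_) L (ContinuousLinearEquiv.ofFinrankEq hdim)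
  rw [hΨ, ← hΦ hm, m.2.2]

end Slice

theorem mainTheorem3 {EG EQ EB G Q B : Type*}
    [NormedAddCommGroup EG] [NormedSpace ℝ EG] [FiniteDimensional ℝ EG]
    [NormedAddCommGroup EQ] [NormedSpace ℝ EQ] [FiniteDimensional ℝ EQ]
    [NormedAddCommGroup EB] [NormedSpace ℝ EB] [FiniteDimensional ℝ EB]
    [TopologicalSpace G] [ChartedSpace EG G] [Group G] [LieGroup 𝓘(ℝ, EG) ∞ G]
    [TopologicalSpace Q] [ChartedSpace EQ Q] [IsManifold 𝓘(ℝ, EQ) ∞ Q]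
    [TopologicalSpace B] [ChartedSpace EB B] [IsManifold 𝓘(ℝ, EB) ∞ B]
    [MulAction G Q]
    (π : Q → B) (hπ : IsSmoothPrincipalBundle (EG := EG) (EQ := EQ) (EB := EB) (G := G) π)
    (γ : Q → G) (hγ : IsLevelFunction (EG := EG) (EQ := EQ) γ) :
    (∀ Hor : Set (Q × Q),
      IsAffineDiscreteConnection (EQ := EQ) (EB := EB) π γ Hor →
        IsOpen (connectionDomain G Hor) ∧
        IsProdInvariant G (connectionDomain G Hor) ∧
        (∀ p ∈ connectionDomain G Hor, ∃! g : G, (p.1, g⁻¹ • p.2) ∈ Hor) ∧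
        ContMDiffOn (𝓘(ℝ, EQ).prod 𝓘(ℝ, EQ)) 𝓘(ℝ, EG) ∞
          (connectionForm G Hor) (connectionDomain G Hor) ∧
        IsConnectionEquivariantOn (connectionForm G Hor) (connectionDomain G Hor) ∧
        Hor = {p | p ∈ connectionDomain G Hor ∧ connectionForm G Hor p = 1}) ∧
    (∀ (U : Set (Q × Q)) (A : Q × Q → G),
      IsOpen U → levelGraph γ ⊆ U → IsProdInvariant G U →
      ContMDiffOn (𝓘(ℝ, EQ).prod 𝓘(ℝ, EQ)) 𝓘(ℝ, EG) ∞ A U →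
      IsConnectionEquivariantOn A U →
      (∀ p ∈ levelGraph γ, A p = 1) →
        IsAffineDiscreteConnection (EQ := EQ) (EB := EB) π γ {p | p ∈ U ∧ A p = 1} ∧
        connectionDomain G {p | p ∈ U ∧ A p = 1} = U ∧
        Set.EqOn (connectionForm G {p | p ∈ U ∧ A p = 1}) A U) := by
  refine ⟨fun Hor hHor => ?_, fun U A hUo hΓU hU hAs hA hΓ => ?_⟩
  · obtain ⟨k, cs, -, hemb, hloc⟩ := hHor.submanifold
    refine ⟨?_, hπ.isProdInvariant_connectionDomain hHor.injOn hHor.invariant, fun p hp => ?_,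
      hπ.contMDiffOn_connectionForm hHor.injOn hemb.contMDiff hloc,
      hπ.isConnectionEquivariantOn_connectionForm hHor.injOn hHor.invariant,
      hπ.eq_setOf_connectionForm_eq_one hHor.injOn⟩
    · rw [hπ.connectionDomain_eq_preimage_range]
      exact hloc.isOpen_range.preimage (continuous_fst.prodMk
        (hπ.contMDiff_proj.continuous.comp continuous_snd))
    · obtain ⟨g, hg⟩ := mem_connectionDomain_iff.1 hp
      exact ⟨g, hg, fun h hh => (hπ.inv_smul_mem_iff hHor.injOn hg h).1 hh⟩
  · have hinj : InjOn (fun p : Q × Q => (p.1, π p.2)) {p | p ∈ U ∧ A p = 1} := by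
      rintro ⟨q₀, q₁⟩ ⟨hp, hp1⟩ ⟨q₀', q₁'⟩ ⟨-, hp1'⟩ h
      obtain ⟨rfl, h₁⟩ := Prod.ext_iff.1 h
      obtain ⟨g, rfl⟩ := (hπ.proj_eq_iff _ _).1 h₁
      have hg : g = 1 := by rw [← hp1', hA.smul_right g hp, hp1, mul_one]
      rw [hg, one_smul]
    have hmem (p : Q × Q) (hp : p ∈ U) : (p.1, (A p)⁻¹ • p.2) ∈ {p | p ∈ U ∧ A p = 1} :=
      ⟨hU.smul_right _ hp, by rw [hA.smul_right _ hp, inv_mul_cancel]⟩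
    refine ⟨⟨fun p hp => ⟨hΓU hp, hΓ p hp⟩, fun g q₀ q₁ h => ⟨hU _ _ _ _ h.1, ?_⟩,
      hπ.exists_submanifold_levelSet hUo hU hAs hA, hinj⟩, ?_,
      fun p hp => hπ.connectionForm_eq hinj (hmem p hp)⟩
    · rw [hA _ _ _ _ h.1, h.2, mul_one, mul_inv_cancel]
    · ext p
      refine ⟨?_, fun hp => mem_connectionDomain_iff.2 ⟨_, hmem p hp⟩⟩
      rintro ⟨g, q, hq, rfl⟩
      exact hU.smul_right g hq.1
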